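/- Let $(S,T)$ be a triangulated closed surface, i.e. take a finite collection $F$ of triangles and identify their edges (sides) in pairs by homeomorphisms (two sides of the same triangle may be identified). Let $E$ be the set of edges of $T$. Each side of a triangle faces exactly one of the three corners of that triangle; thus each edge $e\in E$, being a pair of identified sides, is faced by exactly two corners. For an assignment $x$ of real numbers to the corners, the edge invariant $D_x:E\to\mathbb R$ is defined by letting $D_x(e)$ be the sum of the values of $x$ at the two corners facing $e$. A spherical triangle is a triangle on the unit sphere $S^2$ with three linearly independent vertices, joined by minimizing great circle arcs. A spherical angle structure is an assignment $x$ of numbers in $(0,\pi)$ to the corners such that the three values in each triangle are the inner angles of a spherical triangle (in the given order). A spherical polyhedron metric is a map $l:E\to(0,\pi)$ such that for each triangle the values of $l$ on its three sides are the side lengths of a spherical triangle; its edge invariant is the edge invariant of the inner angles of these spherical triangles. For $D:E\to\mathbb R$, let $AS(S,T;D)$ be the set of all spherical angle structures with edge invariant $D$, a subset of the finite-dimensional space of real functions on the set of corners, and let $\partial AS(S,T;D)=\overline{AS(S,T;D)}\setminus AS(S,T;D)$. A cycle is a cyclic sequence $e_1,f_1,e_2,f_2,\dots,e_n,f_n$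 ($n\ge1$) of edges and triangles in which, with indices modulo $n$, the cycle enters $f_i$ through a side lying on $e_i$, leaves it through a different side lying on $e_{i+1}$, and the latter side is identified with the side through which $f_{i+1}$ is entered. We say that $D$ contains a $\{0,0,\pi\}$-cycle if there are a cycle and a point $a\in\partial AS(S,T;D)$ such that, for every $i$, $D_a(e_i)=\pi$ and the values of $a$ at the three corners of $f_i$ are $0,0,\pi$ in some order. **Theorem.** Let $(S,T)$ be a triangulated closed surface and let $D:E\to(0,\pi]$ contain no $\{0,0,\pi\}$-cycle. If there is a spherical angle structure on $(S,T)$ with edge invariant $D$, then there is a spherical polyhedron metric on $(S,T)$ with edge invariant $D$. -/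

import Mathlib

open Real

noncomputable section

/-- A (nondegenerate) spherical triangle: three linearly independent points of the unit sphere
in `ℝ³`, joined by the minimizing great circle arcs. -/
structure SphericalTriangle where
  vertex : Fin 3 → EuclideanSpace ℝ (Fin 3)
  norm_vertex : ∀ i, ‖vertex i‖ = 1
  linearIndependent : LinearIndependent ℝ vertex

namespace SphericalTriangle

/-- Length of the `i`-th side, that is, the spherical distance between the two vertices other than
the `i`-th one. -/
def sideLength (t : SphericalTriangle) (i : Fin 3) : ℝ :=
  InnerProductGeometry.angle (t.vertex (i + 1)) (t.vertex (i + 2))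

/-- Initial direction at the `i`-th vertex of the great circle arc to the `j`-th vertex: the
component of `vertex j` that is tangent to the sphere at `vertex i`. -/
def direction (t : SphericalTriangle) (i j : Fin 3) : EuclideanSpace ℝ (Fin 3) :=
  t.vertex j - inner ℝ (t.vertex i) (t.vertex j) • t.vertex i

/-- Inner angle at the `i`-th vertex; it faces the `i`-th side. -/
def innerAngle (t : SphericalTriangle) (i : Fin 3) : ℝ :=
  InnerProductGeometry.angle (t.direction i (i + 1)) (t.direction i (i + 2))

theorem inner_vertex_eq (s t : SphericalTriangle) (h : ∀ i, s.sideLength i = t.sideLength i)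
    (i j : Fin 3) :
    inner ℝ (s.vertex i) (s.vertex j) = inner ℝ (t.vertex i) (t.vertex j) := by
  have key : ∀ i, inner ℝ (s.vertex (i + 1)) (s.vertex (i + 2)) =
      inner ℝ (t.vertex (i + 1)) (t.vertex (i + 2)) := by
    intro i
    have := congrArg Real.cos (h i)
    simpa [sideLength, InnerProductGeometry.cos_angle, s.norm_vertex, t.norm_vertex] using this
  have h0 := key 0
  have h1 := key 1
  have h2 := key 2
  have diag : ∀ i, inner ℝ (s.vertex i) (s.vertex i) = inner ℝ (t.vertex i) (t.vertex i) := by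
    intro i
    simp [s.norm_vertex, t.norm_vertex]
  simp only [Fin.isValue, show (0 : Fin 3) + 1 = 1 from rfl, show (0 : Fin 3) + 2 = 2 from rfl,
    show (1 : Fin 3) + 1 = 2 from rfl, show (1 : Fin 3) + 2 = 0 from rfl,
    show (2 : Fin 3) + 1 = 0 from rfl, show (2 : Fin 3) + 2 = 1 from rfl] at h0 h1 h2
  have h0' := h0
  have h1' := h1
  have h2' := h2
  rw [real_inner_comm, real_inner_comm (t.vertex _)] at h0' h1' h2'
  fin_cases i <;> fin_cases j <;> first | exact diag _ | assumption

/-- The side lengths of a spherical triangle determine its inner angles. -/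
theorem innerAngle_eq_of_sideLength_eq (s t : SphericalTriangle)
    (h : ∀ i, s.sideLength i = t.sideLength i) (i : Fin 3) : s.innerAngle i = t.innerAngle i := by
  have hi := inner_vertex_eq s t h
  have hd : ∀ i j k, inner ℝ (s.direction i j) (s.direction i k) =
      inner ℝ (t.direction i j) (t.direction i k) := by
    intro i j k
    simp only [direction, inner_sub_left, inner_sub_right, real_inner_smul_left,
      real_inner_smul_right, hi]
  have hn : ∀ i j, ‖s.direction i j‖ = ‖t.direction i j‖ := by
    intro i j
    rw [norm_eq_sqrt_real_inner, norm_eq_sqrt_real_inner, hd]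
  simp only [innerAngle, InnerProductGeometry.angle, hd, hn]

end SphericalTriangle

/-- A triangulated closed surface: a family of triangles indexed by `F` (finite in use) whose sides
are identified in pairs. The side `(f, i)` of the triangle `f` is the one opposite to its `i`-th
vertex. No further condition is imposed: two sides of the same triangle may be identified, and
two triangles may share several edges or vertices. -/
structure TriangulatedSurface (F : Type*) where
  /-- the side that a given side is identified with -/
  glue : F × Fin 3 → F × Fin 3
  glue_glue : ∀ s, glue (glue s) = s
  glue_ne : ∀ s, glue s ≠ s
  /-- The isotopy class of the identifying homeomorphism from the side `(f, i)` to the side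
  `glue (f, i) = (g, j)`: if `true`, the vertices `i + 1, i + 2` of `f` are sent to the vertices
  `j + 2, j + 1` of `g`, respectively; if `false`, to `j + 1, j + 2`. -/
  reverses : F × Fin 3 → Bool
  reverses_glue : ∀ s, reverses (glue s) = reverses s

namespace TriangulatedSurface

variable {F : Type*} (T : TriangulatedSurface F)

/-- Two sides of triangles give the same edge of the surface. -/
def sideSetoid : Setoid (F × Fin 3) where
  r s t := t = s ∨ t = T.glue s
  iseqv :=
    { refl := fun _ => Or.inl rfl
      symm := by
        rintro s t (rfl | rfl)
        · exact Or.inl rfl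
        · exact Or.inr (T.glue_glue s).symm
      trans := by
        rintro s t u (rfl | rfl) (rfl | rfl)
        · exact Or.inl rfl
        · exact Or.inr rfl
        · exact Or.inr rfl
        · exact Or.inl (T.glue_glue s) }

/-- The edges of the triangulation. -/
def Edge : Type _ := Quotient T.sideSetoid

/-- The edge of the surface given by a side of a triangle. -/
def edge (s : F × Fin 3) : T.Edge := Quotient.mk T.sideSetoid s

/-- The edge invariant of an assignment `x` of numbers to the corners: its value at an edge is the
sum of the two values at the corners facing the edge. The corner facing the side `(f, i)` is the
corner of `f` at its `i`-th vertex, and it is denoted by `(f, i)` too. -/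
def edgeInvariant (x : F × Fin 3 → ℝ) : T.Edge → ℝ :=
  Quotient.lift (fun s => x s + x (T.glue s)) (by
    rintro s t (rfl | rfl)
    · rfl
    · simp only [T.glue_glue]
      exact add_comm _ _)

/-- `x` is a spherical angle structure: the values of `x` at the three corners of each
triangle are the inner angles of a spherical triangle. -/
def IsSphericalAngleStructure (x : F × Fin 3 → ℝ) : Prop :=
  (∀ c, x c ∈ Set.Ioo 0 π) ∧
    ∀ f, ∃ t : SphericalTriangle, ∀ i, t.innerAngle i = x (f, i)

/-- The space of all spherical angle structures with edge invariant `D`. -/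
def angleStructures (D : T.Edge → ℝ) : Set (F × Fin 3 → ℝ) :=
  {x | IsSphericalAngleStructure x ∧ T.edgeInvariant x = D}

/-- A cycle `e₀, f₀, e₁, f₁, …, eₙ, fₙ` of edges and triangles: `eₖ` and `eₖ₊₁` are two different
sides of the triangle `fₖ`, and the triangles on the two sides of `eₖ₊₁` are `fₖ` and `fₖ₊₁`
(indices modulo `n + 1`). -/
structure Cycle where
  n : ℕ
  face : Fin (n + 1) → F
  /-- the side of `face k` through which the cycle enters it -/
  entry : Fin (n + 1) → Fin 3
  /-- the side of `face k` through which the cycle leaves it -/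
  exit : Fin (n + 1) → Fin 3
  entry_ne_exit : ∀ k, entry k ≠ exit k
  glue_exit : ∀ k, T.glue (face k, exit k) = (face (k + 1), entry (k + 1))

/-- `D` contains a `{0, 0, π}`-cycle: for some cycle and some boundary point `a` of the space of
spherical angle structures with edge invariant `D`, the edge invariant of `a` is `π` at all edges
of the cycle, and the angles in `a` of each triangle of the cycle are `0, 0, π` in some order. -/
def ContainsZeroZeroPiCycle (D : T.Edge → ℝ) : Prop :=
  ∃ a ∈ closure (T.angleStructures D) \ T.angleStructures D, ∃ c : T.Cycle, ∀ k,
    T.edgeInvariant a (T.edge (c.face k, c.entry k)) = π ∧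
      ∃ i, a (c.face k, i) = π ∧ ∀ j, j ≠ i → a (c.face k, j) = 0

/-- A spherical polyhedron metric: an assignment of lengths to the edges so that the lengths of the
three sides of each triangle are the side lengths of a spherical triangle. -/
structure SphericalPolyhedronMetric where
  length : T.Edge → ℝ
  length_mem : ∀ e, length e ∈ Set.Ioo 0 π
  exists_triangle : ∀ f, ∃ t : SphericalTriangle, ∀ i, t.sideLength i = length (T.edge (f, i))

namespace SphericalPolyhedronMetric

variable {T}

/-- The inner angles of a spherical polyhedron metric. -/
def innerAngle (l : T.SphericalPolyhedronMetric) (c : F × Fin 3) : ℝ :=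
  (l.exists_triangle c.1).choose.innerAngle c.2

/-- The inner angles do not depend on the choice of the spherical triangles. -/
theorem innerAngle_eq (l : T.SphericalPolyhedronMetric) (f : F) (t : SphericalTriangle)
    (ht : ∀ i, t.sideLength i = l.length (T.edge (f, i))) (i : Fin 3) :
    l.innerAngle (f, i) = t.innerAngle i :=
  SphericalTriangle.innerAngle_eq_of_sideLength_eq _ _
    (fun j => ((l.exists_triangle f).choose_spec j).trans (ht j).symm) i

/-- The edge invariant of a spherical polyhedron metric. -/
def edgeInvariant (l : T.SphericalPolyhedronMetric) : T.Edge → ℝ :=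
  T.edgeInvariant l.innerAngle

end SphericalPolyhedronMetric

end TriangulatedSurface

end

/-! The proof is variational. The angle triples of spherical triangles form an open tetrahedron with
vertices (π,π,π), (π,0,0), (0,π,0), (0,0,π); `angleCoord` gives its barycentric coordinates, scaled
to have sum π. By the dual cosine law the side `l i` facing the angle `x i` satisfies tan² (l i / 2)
= sin A sin Aᵢ / (sin Aⱼ sin Aₖ), where A is the coordinate `none` and Aᵢ, Aⱼ, Aₖ are the others
(`cos_sideLength_eq`). Hence, if `angleEnergy` is the sum of ∫ log sin over all coordinates of all
triangles, its partial derivative at a corner is log tan of half the facing side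
(`hasDerivAt_angleEnergy`).

At a minimum point inside the space of angle structures with edge invariant `D`, one may raise one
corner facing an edge and lower the other by the same amount. Criticality says that the two
triangles at the edge give it the same length, so the triangles fit together to a metric with the
prescribed angles (`sin_mul_sin_div_eq_of_isMinOn`).

A minimum exists on the compact closure. It is not on the boundary: log sin tends to -∞ at 0, so the
energy drops steeply on leaving the boundary inwards if some degenerate triangle is not a vertex of
the tetrahedron (`exists_angleEnergy_segment_lt`). At a vertex the divergent terms can cancel. But
if all degenerate triangles are vertices, `D ≤ π` makes each corner of value π face a corner of
value 0, in a triangle which then has angles 0, 0, π; following these closes up to a forbidden cycle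
(`containsZeroZeroPiCycle_of_mem`). -/

open Real

/-! ### Spherical trigonometry: the cosine law and its dual. -/

namespace SphericalTriangle

/-- The spherical cosine law, with the three instances as hypotheses, implies its dual. -/
theorem cos_mul_sin_mul_sin_eq_of_cosine_law {x₀ x₁ x₂ y₀ y₁ y₂ : ℝ}
    (hx₁ : 0 < sin x₁) (hx₂ : 0 < sin x₂)
    (hy₀ : 0 < sin y₀) (hy₁ : 0 < sin y₁) (hy₂ : 0 < sin y₂)
    (h₀ : sin y₁ * sin y₂ * cos x₀ = cos y₀ - cos y₁ * cos y₂)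
    (h₁ : sin y₂ * sin y₀ * cos x₁ = cos y₁ - cos y₂ * cos y₀)
    (h₂ : sin y₀ * sin y₁ * cos x₂ = cos y₂ - cos y₀ * cos y₁) :
    cos y₀ * (sin x₁ * sin x₂) = cos x₀ + cos x₁ * cos x₂ := by
  have e₀ := sin_sq_add_cos_sq y₀
  have e₁ := sin_sq_add_cos_sq y₁
  have e₂ := sin_sq_add_cos_sq y₂
  have f₁ := sin_sq_add_cos_sq x₁
  have f₂ := sin_sq_add_cos_sq x₂
  -- Δ is the Gram determinant of the vertices. It equals the square of sin yⱼ sin yₖ sin xᵢ for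
  -- each i, which is the sine law.
  set Δ := 1 + 2 * cos y₀ * cos y₁ * cos y₂ - cos y₀ ^ 2 - cos y₁ ^ 2 - cos y₂ ^ 2 with hΔ
  have g₁ : (sin y₂ * sin y₀ * sin x₁) ^ 2 = Δ := by
    have : (sin y₂ * sin y₀ * sin x₁) ^ 2
        = sin y₂ ^ 2 * sin y₀ ^ 2 - (sin y₂ * sin y₀ * cos x₁) ^ 2 := by
      linear_combination (sin y₂ * sin y₀) ^ 2 * f₁
    rw [this, h₁, eq_sub_of_add_eq e₀, eq_sub_of_add_eq e₂, hΔ]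
    ring
  have g₂ : (sin y₀ * sin y₁ * sin x₂) ^ 2 = Δ := by
    have : (sin y₀ * sin y₁ * sin x₂) ^ 2
        = sin y₀ ^ 2 * sin y₁ ^ 2 - (sin y₀ * sin y₁ * cos x₂) ^ 2 := by
      linear_combination (sin y₀ * sin y₁) ^ 2 * f₂
    rw [this, h₂, eq_sub_of_add_eq e₀, eq_sub_of_add_eq e₁, hΔ]
    ring
  have g : sin y₂ * sin y₀ * sin x₁ = sin y₀ * sin y₁ * sin x₂ :=
    (sq_eq_sq₀ (by positivity) (by positivity)).1 (g₁.trans g₂.symm)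
  have key : sin y₀ ^ 2 * sin y₁ * sin y₂ * (sin x₁ * sin x₂) = Δ := by
    rw [← g₁]
    linear_combination - (sin y₂ * sin y₀ * sin x₁) * g
  have hne : sin y₀ ^ 2 * sin y₁ * sin y₂ ≠ 0 := by positivity
  apply mul_left_cancel₀ hne
  have : sin y₀ ^ 2 * sin y₁ * sin y₂ * (cos x₀ + cos x₁ * cos x₂)
      = sin y₀ ^ 2 * (cos y₀ - cos y₁ * cos y₂) +
        (cos y₁ - cos y₂ * cos y₀) * (cos y₂ - cos y₀ * cos y₁) := by
    rw [← h₀, ← h₁, ← h₂]; ring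
  rw [this]
  linear_combination cos y₀ * key - (cos y₀ - cos y₁ * cos y₂) * e₀

variable (t : SphericalTriangle)

theorem cos_sideLength (i : Fin 3) :
    cos (t.sideLength i) = inner ℝ (t.vertex (i + 1)) (t.vertex (i + 2)) := by
  simp [sideLength, InnerProductGeometry.cos_angle, t.norm_vertex]

theorem inner_self_vertex (i : Fin 3) : inner ℝ (t.vertex i) (t.vertex i) = 1 := by
  simp [t.norm_vertex]

theorem direction_ne_zero {i j : Fin 3} (h : i ≠ j) : t.direction i j ≠ 0 := by
  intro h0
  have hinj : Function.Injective ![i, j] := by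
    intro a b hab
    fin_cases a <;> fin_cases b <;> simp_all
  have hli := t.linearIndependent.comp ![i, j] hinj
  rw [show t.vertex ∘ ![i, j] = ![t.vertex i, t.vertex j] by
    funext k; fin_cases k <;> rfl] at hli
  have := LinearIndependent.pair_iff.1 hli (- inner ℝ (t.vertex i) (t.vertex j)) 1 (by
    rw [neg_smul, one_smul, neg_add_eq_sub]; exact h0)
  exact one_ne_zero this.2

theorem norm_direction_sq (i j : Fin 3) :
    ‖t.direction i j‖ ^ 2 = 1 - inner ℝ (t.vertex i) (t.vertex j) ^ 2 := by
  rw [← real_inner_self_eq_norm_sq]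
  simp only [direction, inner_sub_left, inner_sub_right, real_inner_smul_left,
    real_inner_smul_right, inner_self_vertex, real_inner_comm (t.vertex i) (t.vertex j)]
  ring

theorem sideLength_mem (i : Fin 3) : t.sideLength i ∈ Set.Icc 0 π :=
  ⟨InnerProductGeometry.angle_nonneg _ _, InnerProductGeometry.angle_le_pi _ _⟩

theorem innerAngle_mem (i : Fin 3) : t.innerAngle i ∈ Set.Icc 0 π :=
  ⟨InnerProductGeometry.angle_nonneg _ _, InnerProductGeometry.angle_le_pi _ _⟩

theorem norm_direction_add_one (i : Fin 3) :
    ‖t.direction i (i + 1)‖ = sin (t.sideLength (i + 2)) := by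
  refine (sq_eq_sq₀ (norm_nonneg _) (sin_nonneg_of_mem_Icc (t.sideLength_mem _))).1 ?_
  rw [norm_direction_sq, sin_sq, cos_sideLength]
  congr 3 <;> congr 1 <;> fin_cases i <;> rfl

theorem norm_direction_add_two (i : Fin 3) :
    ‖t.direction i (i + 2)‖ = sin (t.sideLength (i + 1)) := by
  refine (sq_eq_sq₀ (norm_nonneg _) (sin_nonneg_of_mem_Icc (t.sideLength_mem _))).1 ?_
  rw [norm_direction_sq, sin_sq, cos_sideLength, real_inner_comm]
  congr 3 <;> congr 1 <;> fin_cases i <;> rfl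

theorem sin_sideLength_pos (i : Fin 3) : 0 < sin (t.sideLength i) := by
  have h := t.norm_direction_add_one (i + 1)
  rw [show i + 1 + 2 = i by fin_cases i <;> rfl] at h
  rw [← h]
  exact norm_pos_iff.2 (t.direction_ne_zero (by fin_cases i <;> decide))

theorem sideLength_mem_Ioo (i : Fin 3) : t.sideLength i ∈ Set.Ioo 0 π := by
  have h := t.sin_sideLength_pos i
  have h' := t.sideLength_mem i
  refine ⟨lt_of_le_of_ne h'.1 fun e => ?_, lt_of_le_of_ne h'.2 fun e => ?_⟩
  · rw [← e] at h; simp at h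
  · rw [e] at h; simp at h

/-- The spherical cosine law. -/
theorem cosine_law (i : Fin 3) :
    sin (t.sideLength (i + 1)) * sin (t.sideLength (i + 2)) * cos (t.innerAngle i) =
      cos (t.sideLength i) - cos (t.sideLength (i + 1)) * cos (t.sideLength (i + 2)) := by
  have h := InnerProductGeometry.cos_angle_mul_norm_mul_norm
    (t.direction i (i + 1)) (t.direction i (i + 2))
  rw [norm_direction_add_one, norm_direction_add_two] at h
  rw [innerAngle, mul_comm, mul_comm (sin (t.sideLength (i + 1))), h]
  simp only [cos_sideLength, direction, inner_sub_left, inner_sub_right, real_inner_smul_left,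
    real_inner_smul_right, inner_self_vertex]
  have e1 : i + 1 + 1 = i + 2 := by fin_cases i <;> rfl
  have e2 : i + 1 + 2 = i := by fin_cases i <;> rfl
  have e3 : i + 2 + 1 = i := by fin_cases i <;> rfl
  have e4 : i + 2 + 2 = i + 1 := by fin_cases i <;> rfl
  rw [e1, e2, e3, e4, real_inner_comm (t.vertex i) (t.vertex (i + 1)),
    real_inner_comm (t.vertex i) (t.vertex (i + 2))]
  ring

/-- The dual spherical cosine law. -/
theorem dual_cosine_law (h : ∀ i, t.innerAngle i ∈ Set.Ioo 0 π) (i : Fin 3) :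
    cos (t.sideLength i) * (sin (t.innerAngle (i + 1)) * sin (t.innerAngle (i + 2))) =
      cos (t.innerAngle i) + cos (t.innerAngle (i + 1)) * cos (t.innerAngle (i + 2)) := by
  have e1 : i + 1 + 1 = i + 2 := by fin_cases i <;> rfl
  have e2 : i + 1 + 2 = i := by fin_cases i <;> rfl
  have e3 : i + 2 + 1 = i := by fin_cases i <;> rfl
  have e4 : i + 2 + 2 = i + 1 := by fin_cases i <;> rfl
  have h₁ := t.cosine_law (i + 1)
  have h₂ := t.cosine_law (i + 2)
  rw [e1, e2] at h₁
  rw [e3, e4] at h₂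
  exact cos_mul_sin_mul_sin_eq_of_cosine_law (sin_pos_of_mem_Ioo (h _)) (sin_pos_of_mem_Ioo (h _))
    (t.sin_sideLength_pos _) (t.sin_sideLength_pos _) (t.sin_sideLength_pos _)
    (t.cosine_law i) h₁ h₂

/-- A spherical triangle with two given sides and the given angle between them. -/
theorem exists_of_sides_of_angle {x y₁ y₂ : ℝ} (hx : 0 < sin x) (h₁ : 0 < sin y₁)
    (h₂ : 0 < sin y₂) :
    ∃ t : SphericalTriangle, cos (t.sideLength 1) = cos y₁ ∧ cos (t.sideLength 2) = cos y₂ ∧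
      cos (t.sideLength 0) = cos y₁ * cos y₂ + sin y₁ * sin y₂ * cos x := by
  -- Vertex 0 carries the angle `x`; vertices 1 and 2 lie at distances `y₂` and `y₁` from it.
  let v : Fin 3 → EuclideanSpace ℝ (Fin 3) :=
    ![!₂[1, 0, 0], !₂[cos y₂, sin y₂, 0], !₂[cos y₁, sin y₁ * cos x, sin y₁ * sin x]]
  have hv : ∀ i, ‖v i‖ = 1 := by
    intro i
    rw [EuclideanSpace.norm_eq, sqrt_eq_one, Fin.sum_univ_three]
    fin_cases i
    · simp [v]
    · simp [v]
    · simp only [v, norm_eq_abs, sq_abs]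
      simp
      nlinarith [sin_sq_add_cos_sq y₁, sin_sq_add_cos_sq x]
  have hli : LinearIndependent ℝ v := by
    rw [Fintype.linearIndependent_iff]
    intro g hg
    rw [Fin.sum_univ_three] at hg
    have c0 := congrArg (fun w : EuclideanSpace ℝ (Fin 3) => w 0) hg
    have c1 := congrArg (fun w : EuclideanSpace ℝ (Fin 3) => w 1) hg
    have c2 := congrArg (fun w : EuclideanSpace ℝ (Fin 3) => w 2) hg
    simp [v] at c0 c1 c2
    have g2 : g 2 = 0 := by
      rcases c2 with c | c | c
      · exact c
      · exact absurd c h₁.ne'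
      · exact absurd c hx.ne'
    have g1 : g 1 = 0 := by
      simpa [g2, h₂.ne'] using c1
    have g0 : g 0 = 0 := by simpa [g1, g2] using c0
    intro i
    fin_cases i <;> assumption
  refine ⟨⟨v, hv, hli⟩, ?_, ?_, ?_⟩ <;> rw [cos_sideLength]
  · simp [v, PiLp.inner_apply, Fin.sum_univ_three]
  · simp [v, PiLp.inner_apply, Fin.sum_univ_three]
  · simp [v, PiLp.inner_apply, Fin.sum_univ_three]
    ring

/-! ### The tetrahedron of angle triples. -/

/-- The barycentric coordinates (up to the factor `π`) of a triple of angles with respect to the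
tetrahedron of all triples of angles of spherical triangles. -/
noncomputable def angleCoord (x : Fin 3 → ℝ) : Option (Fin 3) → ℝ
  | none => (x 0 + x 1 + x 2 - π) / 2
  | some i => (π + x i - x (i + 1) - x (i + 2)) / 2

theorem sum_angleCoord (x : Fin 3 → ℝ) : ∑ m, angleCoord x m = π := by
  rw [Fintype.sum_option, Fin.sum_univ_three]
  simp only [angleCoord]
  simp only [Fin.isValue, show (0 : Fin 3) + 1 = 1 from rfl, show (0 : Fin 3) + 2 = 2 from rfl,
    show (1 : Fin 3) + 1 = 2 from rfl, show (1 : Fin 3) + 2 = 0 from rfl,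
    show (2 : Fin 3) + 1 = 0 from rfl, show (2 : Fin 3) + 2 = 1 from rfl]
  ring

theorem add_add_eq_sum_cyclic (x : Fin 3 → ℝ) (i : Fin 3) :
    x 0 + x 1 + x 2 = x i + x (i + 1) + x (i + 2) := by
  fin_cases i
  · rfl
  · change _ = x 1 + x 2 + x 0
    ring
  · change _ = x 2 + x 0 + x 1
    ring

theorem angleCoord_none (x : Fin 3 → ℝ) (i : Fin 3) :
    angleCoord x none = (x i + x (i + 1) + x (i + 2) - π) / 2 := by
  rw [angleCoord, add_add_eq_sum_cyclic x i]

theorem angleCoord_none_add_some (x : Fin 3 → ℝ) (i : Fin 3) :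
    angleCoord x none + angleCoord x (some i) = x i := by
  rw [angleCoord_none x i, angleCoord]; ring

theorem angleCoord_some_add_one (x : Fin 3 → ℝ) (i : Fin 3) :
    angleCoord x (some (i + 1)) = (π + x (i + 1) - x i - x (i + 2)) / 2 := by
  have e1 : i + 1 + 1 = i + 2 := by fin_cases i <;> rfl
  have e2 : i + 1 + 2 = i := by fin_cases i <;> rfl
  rw [angleCoord, e1, e2]; ring

theorem angleCoord_some_add_two (x : Fin 3 → ℝ) (i : Fin 3) :
    angleCoord x (some (i + 2)) = (π + x (i + 2) - x i - x (i + 1)) / 2 := by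
  have e3 : i + 2 + 1 = i := by fin_cases i <;> rfl
  have e4 : i + 2 + 2 = i + 1 := by fin_cases i <;> rfl
  rw [angleCoord, e3, e4]

theorem two_mul_sin_angleCoord_none_mul_some (x : Fin 3 → ℝ) (i : Fin 3) :
    2 * sin (angleCoord x none) * sin (angleCoord x (some i)) =
      sin (x (i + 1)) * sin (x (i + 2)) - (cos (x i) + cos (x (i + 1)) * cos (x (i + 2))) := by
  rw [angleCoord_none x i, angleCoord, two_mul_sin_mul_sin,
    show (x i + x (i + 1) + x (i + 2) - π) / 2 - (π + x i - x (i + 1) - x (i + 2)) / 2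
      = x (i + 1) + x (i + 2) - π by ring,
    show (x i + x (i + 1) + x (i + 2) - π) / 2 + (π + x i - x (i + 1) - x (i + 2)) / 2
      = x i by ring, cos_sub_pi, cos_add]
  ring

theorem two_mul_sin_angleCoord_mul (x : Fin 3 → ℝ) (i : Fin 3) :
    2 * sin (angleCoord x (some (i + 1))) * sin (angleCoord x (some (i + 2))) =
      sin (x (i + 1)) * sin (x (i + 2)) + (cos (x i) + cos (x (i + 1)) * cos (x (i + 2))) := by
  rw [angleCoord_some_add_one, angleCoord_some_add_two, two_mul_sin_mul_sin,
    show (π + x (i + 1) - x i - x (i + 2)) / 2 - (π + x (i + 2) - x i - x (i + 1)) / 2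
      = x (i + 1) - x (i + 2) by ring,
    show (π + x (i + 1) - x i - x (i + 2)) / 2 + (π + x (i + 2) - x i - x (i + 1)) / 2
      = π - x i by ring, cos_pi_sub, cos_sub]
  ring

theorem angleCoord_mem_Ioo {x : Fin 3 → ℝ} (h : ∀ m, 0 < angleCoord x m) (m : Option (Fin 3)) :
    angleCoord x m ∈ Set.Ioo 0 π := by
  refine ⟨h m, ?_⟩
  rw [← sum_angleCoord x]
  obtain ⟨m', hm'⟩ := exists_ne m
  exact Finset.single_lt_sum hm' (Finset.mem_univ _) (Finset.mem_univ _) (h _)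
    fun _ _ _ => (h _).le

theorem mem_Ioo_of_angleCoord_pos {x : Fin 3 → ℝ} (h : ∀ m, 0 < angleCoord x m) (i : Fin 3) :
    x i ∈ Set.Ioo 0 π := by
  have h0 := h none
  have h1 := h (some (i + 1))
  have h2 := h (some (i + 2))
  have hi := h (some i)
  rw [angleCoord_some_add_one] at h1
  rw [angleCoord_some_add_two] at h2
  rw [← angleCoord_none_add_some x i]
  refine ⟨by linarith, ?_⟩
  rw [angleCoord_none_add_some]
  linarith

/-- The dual half-angle formula, in two parts. -/
theorem one_sub_cos_sideLength_mul (h : ∀ i, t.innerAngle i ∈ Set.Ioo 0 π) (i : Fin 3) :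
    (1 - cos (t.sideLength i)) * (sin (t.innerAngle (i + 1)) * sin (t.innerAngle (i + 2))) =
      2 * sin (angleCoord t.innerAngle none) * sin (angleCoord t.innerAngle (some i)) := by
  rw [two_mul_sin_angleCoord_none_mul_some, ← t.dual_cosine_law h]; ring

theorem one_add_cos_sideLength_mul (h : ∀ i, t.innerAngle i ∈ Set.Ioo 0 π) (i : Fin 3) :
    (1 + cos (t.sideLength i)) * (sin (t.innerAngle (i + 1)) * sin (t.innerAngle (i + 2))) =
      2 * sin (angleCoord t.innerAngle (some (i + 1))) *
        sin (angleCoord t.innerAngle (some (i + 2))) := by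
  rw [two_mul_sin_angleCoord_mul, ← t.dual_cosine_law h]; ring

theorem abs_cos_lt_one {y : ℝ} (h : 0 < sin y) : -1 < cos y ∧ cos y < 1 := by
  constructor <;> nlinarith [sin_sq_add_cos_sq y]

/-- By the half-angle formula, the sine of the coordinate `none` has the same sign as that of each
other coordinate. All coordinates lie in (-π, π), so they share this sign, and it is positive since
two of them add up to an angle. -/
theorem angleCoord_innerAngle_pos (h : ∀ i, t.innerAngle i ∈ Set.Ioo 0 π) (m : Option (Fin 3)) :
    0 < angleCoord t.innerAngle m := by
  set x := t.innerAngle with hx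
  have hs : ∀ i, 0 < sin (x i) := fun i => sin_pos_of_mem_Ioo (h i)
  have A : ∀ i, 0 < sin (angleCoord x none) * sin (angleCoord x (some i)) := fun i => by
    have h1 := t.one_sub_cos_sideLength_mul h i
    have h2 : 0 < 1 - cos (t.sideLength i) := by
      linarith [(abs_cos_lt_one (t.sin_sideLength_pos i)).2]
    have := mul_pos h2 (mul_pos (hs (i + 1)) (hs (i + 2)))
    rw [h1] at this
    linarith
  have key : ∀ m, angleCoord x m < π ∧ -π < angleCoord x m := by
    rintro (_ | i)
    · have := h 0; have := h 1; have := h 2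
      simp only [angleCoord, Set.mem_Ioo] at *
      constructor <;> linarith
    · have := h i; have := h (i + 1); have := h (i + 2)
      simp only [angleCoord, Set.mem_Ioo] at *
      constructor <;> linarith
  have hpos : ∀ m, 0 < sin (angleCoord x m) → 0 < angleCoord x m := fun m hm => by
    by_contra! hc
    exact absurd (sin_nonpos_of_nonpos_of_neg_pi_le hc (key m).2.le) (not_le.2 hm)
  have hneg : ∀ m, sin (angleCoord x m) < 0 → angleCoord x m < 0 := fun m hm => by
    by_contra! hc
    exact absurd (sin_nonneg_of_nonneg_of_le_pi hc (key m).1.le) (not_le.2 hm)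
  rcases pos_and_pos_or_neg_and_neg_of_mul_pos (A 0) with h0 | h0
  · refine hpos _ ?_
    rcases m with _ | i
    · exact h0.1
    · exact (pos_iff_pos_of_mul_pos (A i)).1 h0.1
  · exfalso
    have hi := hneg _ h0.2
    have hn := hneg _ h0.1
    have := angleCoord_none_add_some x 0
    have := (h 0).1
    linarith

/-- The dual cosine law prescribes the cosines of the sides, and the half-angle identities put them
in (-1, 1). Polar duality turns the dual law back into the cosine law, so the triangle built from
two of these sides and the angle between them has all the required angles. -/
theorem exists_of_angleCoord_pos {x : Fin 3 → ℝ} (h : ∀ m, 0 < angleCoord x m) :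
    ∃ t : SphericalTriangle, ∀ i, t.innerAngle i = x i := by
  have hx := mem_Ioo_of_angleCoord_pos h
  have hs : ∀ i, 0 < sin (x i) := fun i => sin_pos_of_mem_Ioo (hx i)
  have hp : ∀ m, 0 < sin (angleCoord x m) := fun m => sin_pos_of_mem_Ioo (angleCoord_mem_Ioo h m)
  let c : Fin 3 → ℝ := fun i =>
    (cos (x i) + cos (x (i + 1)) * cos (x (i + 2))) / (sin (x (i + 1)) * sin (x (i + 2)))
  have hc : ∀ i, c i * (sin (x (i + 1)) * sin (x (i + 2))) =
      cos (x i) + cos (x (i + 1)) * cos (x (i + 2)) := fun i =>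
    div_mul_cancel₀ _ (mul_pos (hs _) (hs _)).ne'
  have hc1 : ∀ i, -1 < c i ∧ c i < 1 := fun i => by
    have hss := mul_pos (hs (i + 1)) (hs (i + 2))
    constructor
    · have h1 := two_mul_sin_angleCoord_mul x i
      have := mul_pos (mul_pos two_pos (hp (some (i + 1)))) (hp (some (i + 2)))
      rw [lt_div_iff₀ hss]
      linarith
    · have h1 := two_mul_sin_angleCoord_none_mul_some x i
      have := mul_pos (mul_pos two_pos (hp none)) (hp (some i))
      rw [div_lt_iff₀ hss]
      linarith
  let y : Fin 3 → ℝ := fun i => arccos (c i)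
  have hcy : ∀ i, cos (y i) = c i := fun i => cos_arccos (hc1 i).1.le (hc1 i).2.le
  have hsy : ∀ i, 0 < sin (y i) := fun i => by
    rw [sin_arccos]
    exact sqrt_pos.2 (by nlinarith [hc1 i])
  have law : ∀ i, sin (y (i + 1)) * sin (y (i + 2)) * cos (x i) =
      cos (y i) - cos (y (i + 1)) * cos (y (i + 2)) := fun i => by
    have e1 : i + 1 + 1 = i + 2 := by fin_cases i <;> rfl
    have e2 : i + 1 + 2 = i := by fin_cases i <;> rfl
    have e3 : i + 2 + 1 = i := by fin_cases i <;> rfl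
    have e4 : i + 2 + 2 = i + 1 := by fin_cases i <;> rfl
    have h0 := hc i
    have h1 := hc (i + 1)
    have h2 := hc (i + 2)
    rw [e1, e2] at h1
    rw [e3, e4] at h2
    rw [← hcy] at h0 h1 h2
    -- The polar triangle has sides π - x and angles π - y.
    have := cos_mul_sin_mul_sin_eq_of_cosine_law (x₀ := π - y i) (x₁ := π - y (i + 1))
      (x₂ := π - y (i + 2)) (y₀ := π - x i) (y₁ := π - x (i + 1)) (y₂ := π - x (i + 2))
      (by simpa using hsy _) (by simpa using hsy _) (by simpa using hs _) (by simpa using hs _)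
      (by simpa using hs _)
      (by simp only [sin_pi_sub, cos_pi_sub]; linarith)
      (by simp only [sin_pi_sub, cos_pi_sub]; linarith)
      (by simp only [sin_pi_sub, cos_pi_sub]; linarith)
    simp only [sin_pi_sub, cos_pi_sub] at this
    linarith
  obtain ⟨t, ht1, ht2, ht0⟩ := exists_of_sides_of_angle (hs 0) (hsy 1) (hsy 2)
  have ht0' : cos (t.sideLength 0) = cos (y 0) := by
    have := law 0
    simp only [Fin.isValue, zero_add] at this
    linarith
  have hty : ∀ i, t.sideLength i = y i := by
    have hy : ∀ i, y i ∈ Set.Icc 0 π := fun i => ⟨arccos_nonneg _, arccos_le_pi _⟩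
    intro i
    refine injOn_cos (t.sideLength_mem i) (hy i) ?_
    fin_cases i <;> assumption
  refine ⟨t, fun i => injOn_cos (t.innerAngle_mem i) ⟨(hx i).1.le, (hx i).2.le⟩ ?_⟩
  have h1 := t.cosine_law i
  simp only [hty] at h1
  rw [← law i] at h1
  exact mul_left_cancel₀ (mul_pos (hsy _) (hsy _)).ne' h1

theorem exists_innerAngle_eq_iff {x : Fin 3 → ℝ} :
    ((∀ i, x i ∈ Set.Ioo 0 π) ∧ ∃ t : SphericalTriangle, ∀ i, t.innerAngle i = x i) ↔
      ∀ m, 0 < angleCoord x m := by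
  constructor
  · rintro ⟨hx, t, ht⟩
    obtain rfl : t.innerAngle = x := funext ht
    exact t.angleCoord_innerAngle_pos hx
  · exact fun h => ⟨mem_Ioo_of_angleCoord_pos h, exists_of_angleCoord_pos h⟩

/-- The side `i` of a spherical triangle is determined by this function of its angles. -/
theorem cos_sideLength_eq (h : ∀ i, t.innerAngle i ∈ Set.Ioo 0 π) (i : Fin 3) :
    (1 - cos (t.sideLength i)) / (1 + cos (t.sideLength i)) =
      sin (angleCoord t.innerAngle none) * sin (angleCoord t.innerAngle (some i)) /
        (sin (angleCoord t.innerAngle (some (i + 1))) *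
          sin (angleCoord t.innerAngle (some (i + 2)))) := by
  have hs : 0 < sin (t.innerAngle (i + 1)) * sin (t.innerAngle (i + 2)) :=
    mul_pos (sin_pos_of_mem_Ioo (h _)) (sin_pos_of_mem_Ioo (h _))
  rw [← mul_div_mul_right _ _ hs.ne', one_sub_cos_sideLength_mul t h,
    one_add_cos_sideLength_mul t h, mul_assoc, mul_assoc, mul_div_mul_left _ _ two_ne_zero]

end SphericalTriangle

/-! ### Sums of functions bounded above, and the integral of log sin. -/

open Filter Topology in
theorem tendsto_sum_atBot_of_eventually_le {ι α : Type*} [Fintype ι] {l : Filter α}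
    {g : ι → α → ℝ} (hb : ∀ i, ∃ C, ∀ᶠ t in l, g i t ≤ C) {j : ι}
    (hj : Tendsto (g j) l atBot) : Tendsto (fun t => ∑ i, g i t) l atBot := by
  classical
  choose C hC using hb
  refine tendsto_atBot_mono' l ?_
    (tendsto_atBot_add_const_right l (∑ i ∈ Finset.univ.erase j, C i) hj)
  filter_upwards [eventually_all.2 hC] with t ht
  rw [← Finset.add_sum_erase _ _ (Finset.mem_univ j)]
  gcongr with i _
  exact ht i

open Filter in
theorem exists_eventually_sum_le {ι α : Type*} [Fintype ι] {l : Filter α}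
    {g : ι → α → ℝ} (hb : ∀ i, ∃ C, ∀ᶠ t in l, g i t ≤ C) :
    ∃ C, ∀ᶠ t in l, ∑ i, g i t ≤ C := by
  choose C hC using hb
  refine ⟨∑ i, C i, ?_⟩
  filter_upwards [eventually_all.2 hC] with t ht
  exact Finset.sum_le_sum fun i _ => ht i

/-- The integral of `log ∘ sin`; it is the Lobachevsky function up to sign and a linear term. -/
noncomputable def logSinPrimitive (a : ℝ) : ℝ := ∫ t in (0 : ℝ)..a, log (sin t)

/-- The singularities of log sin are integrable, so the energy stays continuous up to the boundary
of the tetrahedron. -/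
theorem continuous_logSinPrimitive : Continuous logSinPrimitive :=
  intervalIntegral.continuous_primitive (fun _ _ => intervalIntegrable_log_sin) 0

theorem hasDerivAt_logSinPrimitive {a : ℝ} (ha : a ∈ Set.Ioo 0 π) :
    HasDerivAt logSinPrimitive (log (sin a)) a := by
  refine intervalIntegral.integral_hasDerivAt_right intervalIntegrable_log_sin ?_ ?_
  · exact (measurable_log.comp measurable_sin).stronglyMeasurable.stronglyMeasurableAtFilter
  · exact continuous_sin.continuousAt.log (sin_pos_of_mem_Ioo ha).ne'

/-! ### The derivative of the energy of one triangle along a segment leaving the boundary. -/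

section Segment

open Filter Topology

variable {ι : Type*} {a b : ι → ℝ}

theorem tendsto_mul_log_sin_atBot {b : ℝ} (hb : 0 < b) :
    Tendsto (fun t => b * log (sin (0 + t * b))) (𝓝[>] 0) atBot := by
  refine Tendsto.const_mul_atBot hb (tendsto_log_nhdsGT_zero.comp ?_)
  refine tendsto_nhdsWithin_iff.2 ⟨?_, ?_⟩
  · have : Continuous fun t : ℝ => sin (0 + t * b) := by fun_prop
    simpa using (this.tendsto 0).mono_left nhdsWithin_le_nhds
  · have h1 : ∀ᶠ t in 𝓝[>] (0 : ℝ), t < π / b :=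
      nhdsWithin_le_nhds (Iio_mem_nhds (by positivity))
    filter_upwards [self_mem_nhdsWithin, h1] with t ht ht1
    rw [lt_div_iff₀ hb] at ht1
    rw [zero_add]
    exact sin_pos_of_mem_Ioo ⟨mul_pos ht hb, ht1⟩

theorem exists_eventually_mul_log_sin_le {a b : ℝ} (ha : 0 ≤ a) (ha' : a < π)
    (hb : a = 0 → 0 < b) :
    ∃ C, ∀ᶠ t in 𝓝[>] (0 : ℝ), b * log (sin (a + t * b)) ≤ C := by
  rcases ha.eq_or_lt with rfl | ha
  · exact ⟨0, (tendsto_mul_log_sin_atBot (hb rfl)).eventually_le_atBot 0⟩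
  · have h : ContinuousAt (fun t : ℝ => b * log (sin (a + t * b))) 0 := by
      refine continuousAt_const.mul (ContinuousAt.log (by fun_prop) ?_)
      simpa using (sin_pos_of_mem_Ioo ⟨ha, ha'⟩).ne'
    exact ⟨_, ((h.tendsto.mono_left nhdsWithin_le_nhds).eventually_lt_const
      (lt_add_one _)).mono fun t => le_of_lt⟩

variable [Fintype ι]

/-- At a vertex of the simplex the coordinate leaving π contributes -B log sin (t B), where B is the
sum of the other slopes. Distributing this over the other terms leaves b (log sin (t b) - log sin (t
B)) with b ≤ B, which is nonpositive. -/
theorem eventually_sum_mul_log_sin_le_zero (ha : ∀ m, 0 ≤ a m) (hsum : ∑ m, a m = π)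
    (hb : ∀ m, a m = 0 → 0 < b m) (hbsum : ∑ m, b m = 0) {p : ι} (hp : a p = π) :
    ∀ᶠ t in 𝓝[>] (0 : ℝ), ∑ m, b m * log (sin (a m + t * b m)) ≤ 0 := by
  classical
  have ha0 : ∀ m ∈ Finset.univ.erase p, a m = 0 := by
    refine (Finset.sum_eq_zero_iff_of_nonneg fun m _ => ha m).1 ?_
    rw [← Finset.add_sum_erase _ _ (Finset.mem_univ p)] at hsum
    linarith
  set B := ∑ m ∈ Finset.univ.erase p, b m with hB
  have hbp : b p = -B := by
    rw [← Finset.add_sum_erase _ _ (Finset.mem_univ p)] at hbsum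
    linarith
  have hb0 : ∀ m ∈ Finset.univ.erase p, 0 < b m := fun m hm => hb m (ha0 m hm)
  have hB0 : 0 ≤ B := Finset.sum_nonneg fun m hm => (hb0 m hm).le
  -- Below π / 2 the sine is monotone.
  have h1 : ∀ᶠ t in 𝓝[>] (0 : ℝ), t * B < π / 2 := by
    have : Continuous fun t : ℝ => t * B := by fun_prop
    refine ((this.tendsto 0).mono_left nhdsWithin_le_nhds).eventually_lt_const ?_
    rw [zero_mul]; positivity
  filter_upwards [self_mem_nhdsWithin, h1] with t ht ht1
  have ht : 0 < t := ht
  rw [← Finset.add_sum_erase _ _ (Finset.mem_univ p), hp, hbp,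
    show π + t * -B = π - t * B by ring, sin_pi_sub, hB, neg_mul, Finset.sum_mul, ← hB,
    neg_add_eq_sub, ← Finset.sum_sub_distrib]
  refine Finset.sum_nonpos fun m hm => ?_
  rw [ha0 m hm, zero_add, ← mul_sub]
  have hmB : b m ≤ B := Finset.single_le_sum (fun m hm => (hb0 m hm).le) hm
  have hm0 := hb0 m hm
  have hle : t * b m ≤ t * B := by gcongr
  have htm : 0 < t * b m := by positivity
  refine mul_nonpos_of_nonneg_of_nonpos hm0.le (sub_nonpos.2 (log_le_log ?_ ?_))
  · exact sin_pos_of_mem_Ioo ⟨htm, by linarith [pi_pos]⟩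
  · exact sin_le_sin_of_le_of_le_pi_div_two (by linarith) ht1.le hle

theorem lt_pi_of_sum_eq_pi (ha : ∀ m, 0 ≤ a m) (hsum : ∑ m, a m = π) (hne : ∀ m, a m ≠ π)
    (m : ι) : a m < π := by
  refine lt_of_le_of_ne ?_ (hne m)
  rw [← hsum]
  exact Finset.single_le_sum (fun m _ => ha m) (Finset.mem_univ m)

theorem exists_eventually_sum_mul_log_sin_le (ha : ∀ m, 0 ≤ a m) (hsum : ∑ m, a m = π)
    (hb : ∀ m, a m = 0 → 0 < b m) (hbsum : ∑ m, b m = 0) :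
    ∃ C, ∀ᶠ t in 𝓝[>] (0 : ℝ), ∑ m, b m * log (sin (a m + t * b m)) ≤ C := by
  by_cases hp : ∃ p, a p = π
  · obtain ⟨p, hp⟩ := hp
    exact ⟨0, eventually_sum_mul_log_sin_le_zero ha hsum hb hbsum hp⟩
  · exact exists_eventually_sum_le fun m =>
      exists_eventually_mul_log_sin_le (ha m) (lt_pi_of_sum_eq_pi ha hsum (not_exists.1 hp) m) (hb m)

/-- Away from the vertices no coordinate is π, so the only singular terms come from vanishing
coordinates; these have positive slope and tend to -∞, with nothing to compensate them. -/
theorem tendsto_sum_mul_log_sin_atBot (ha : ∀ m, 0 ≤ a m) (hsum : ∑ m, a m = π)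
    (hb : ∀ m, a m = 0 → 0 < b m) (hp : ∀ m, a m ≠ π) {q : ι} (hq : a q = 0) :
    Tendsto (fun t => ∑ m, b m * log (sin (a m + t * b m))) (𝓝[>] 0) atBot := by
  refine tendsto_sum_atBot_of_eventually_le (j := q) (fun m =>
    exists_eventually_mul_log_sin_le (ha m) (lt_pi_of_sum_eq_pi ha hsum hp m) (hb m)) ?_
  rw [hq]
  exact tendsto_mul_log_sin_atBot (hb q hq)

end Segment

open SphericalTriangle

/-! ### The energy and its derivatives. -/

section Energy

variable {F : Type*}

/-- The coordinates `SphericalTriangle.angleCoord` of the angles in the triangle `f`. -/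
noncomputable def faceCoord (x : F × Fin 3 → ℝ) (f : F) : Option (Fin 3) → ℝ :=
  angleCoord fun i => x (f, i)

theorem sum_faceCoord (x : F × Fin 3 → ℝ) (f : F) : ∑ m, faceCoord x f m = π :=
  sum_angleCoord _

theorem continuous_faceCoord (f : F) (m : Option (Fin 3)) :
    Continuous fun x : F × Fin 3 → ℝ => faceCoord x f m := by
  rcases m with _ | i <;> simp only [faceCoord, angleCoord] <;> fun_prop

theorem faceCoord_segment (a x : F × Fin 3 → ℝ) (t : ℝ) (f : F) (m : Option (Fin 3)) :
    faceCoord (a + t • (x - a)) f m =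
      faceCoord a f m + t * (faceCoord x f m - faceCoord a f m) := by
  rcases m with _ | i <;>
    simp only [faceCoord, angleCoord, Pi.add_apply, Pi.smul_apply, Pi.sub_apply, smul_eq_mul] <;>
    ring

theorem isSphericalAngleStructure_iff {x : F × Fin 3 → ℝ} :
    TriangulatedSurface.IsSphericalAngleStructure x ↔ ∀ f m, 0 < faceCoord x f m := by
  rw [TriangulatedSurface.IsSphericalAngleStructure]
  constructor
  · exact fun h f => exists_innerAngle_eq_iff.1 ⟨fun i => h.1 (f, i), h.2 f⟩
  · exact fun h => ⟨fun c => (exists_innerAngle_eq_iff.2 (h c.1)).1 c.2,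
      fun f => (exists_innerAngle_eq_iff.2 (h f)).2⟩

variable [Fintype F]

/-- The energy that is minimized by the angles of spherical polyhedron metrics. -/
noncomputable def angleEnergy (x : F × Fin 3 → ℝ) : ℝ :=
  ∑ f, ∑ m, logSinPrimitive (faceCoord x f m)

theorem continuous_angleEnergy : Continuous (angleEnergy : (F × Fin 3 → ℝ) → ℝ) :=
  continuous_finsetSum _ fun f _ => continuous_finsetSum _ fun m _ =>
    continuous_logSinPrimitive.comp (continuous_faceCoord f m)

open Filter Topology in
/-- The energy decreases when one leaves, towards the interior, a boundary point that has
a degenerate triangle which is not a vertex of the tetrahedron of all triples of angles. -/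
theorem exists_angleEnergy_segment_lt {a x : F × Fin 3 → ℝ} (ha : ∀ f m, 0 ≤ faceCoord a f m)
    (hx : ∀ f m, 0 < faceCoord x f m) {f₀ : F} {q : Option (Fin 3)} (hq : faceCoord a f₀ q = 0)
    (hp : ∀ m, faceCoord a f₀ m ≠ π) :
    ∃ t ∈ Set.Ioc (0 : ℝ) 1, angleEnergy (a + t • (x - a)) < angleEnergy a := by
  set b : F → Option (Fin 3) → ℝ := fun f m => faceCoord x f m - faceCoord a f m with hbdef
  have hb : ∀ f m, faceCoord a f m = 0 → 0 < b f m := fun f m h => by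
    simp only [hbdef, h, sub_zero, hx]
  have hbsum : ∀ f, ∑ m, b f m = 0 := fun f => by
    simp only [hbdef, Finset.sum_sub_distrib, sum_faceCoord, sub_self]
  -- The triangle `f₀` contributes -∞; the others, degenerate or not, are bounded above.
  have hlim : Tendsto (fun t => ∑ f, ∑ m, b f m * log (sin (faceCoord a f m + t * b f m)))
      (𝓝[>] (0 : ℝ)) atBot :=
    tendsto_sum_atBot_of_eventually_le (j := f₀)
      (fun f => exists_eventually_sum_mul_log_sin_le (ha f) (sum_faceCoord a f) (hb f) (hbsum f))
      (tendsto_sum_mul_log_sin_atBot (ha f₀) (sum_faceCoord a f₀) (hb f₀) hp hq)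
  obtain ⟨δ, hδ, hneg⟩ := mem_nhdsGT_iff_exists_Ioo_subset.1 (hlim.eventually_lt_atBot 0)
  have hδ : 0 < δ := hδ
  set d := min δ 1 with hd
  have hd0 : 0 < d := lt_min hδ one_pos
  have hderiv : ∀ t ∈ Set.Ioo 0 d, HasDerivAt (fun t : ℝ => angleEnergy (a + t • (x - a)))
      (∑ f, ∑ m, b f m * log (sin (faceCoord a f m + t * b f m))) t := fun t ht => by
    have ht1 : t < 1 := ht.2.trans_le (min_le_right _ _)
    unfold angleEnergy
    refine HasDerivAt.fun_sum fun f _ => HasDerivAt.fun_sum fun m _ => ?_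
    simp only [faceCoord_segment]
    rw [mul_comm]
    refine HasDerivAt.comp t (hasDerivAt_logSinPrimitive ?_) ?_
    · rw [← faceCoord_segment]
      refine angleCoord_mem_Ioo (fun m => ?_) m
      change 0 < faceCoord (a + t • (x - a)) f m
      rw [faceCoord_segment]
      nlinarith [mul_nonneg (sub_pos.2 ht1).le (ha f m), mul_pos ht.1 (hx f m)]
    · simpa using ((hasDerivAt_id t).mul_const (b f m)).const_add (faceCoord a f m)
  -- At t = 0 the derivative may not exist, but continuity there suffices.
  have hanti : StrictAntiOn (fun t : ℝ => angleEnergy (a + t • (x - a))) (Set.Icc 0 d) := by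
    refine strictAntiOn_of_deriv_neg (convex_Icc _ _) ?_ ?_
    · exact (continuous_angleEnergy.comp (by fun_prop)).continuousOn
    · rw [interior_Icc]
      intro t ht
      rw [(hderiv t ht).deriv]
      exact hneg ⟨ht.1, ht.2.trans_le (min_le_left _ _)⟩
  refine ⟨d, ⟨hd0, min_le_right _ _⟩, ?_⟩
  simpa using hanti (Set.left_mem_Icc.2 hd0.le) (Set.right_mem_Icc.2 hd0.le) hd0

/-- The derivative of the energy at a spherical angle structure. -/
theorem hasDerivAt_angleEnergy {a v : F × Fin 3 → ℝ} (ha : ∀ f m, 0 < faceCoord a f m) :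
    HasDerivAt (fun t : ℝ => angleEnergy (a + t • v))
      (∑ c : F × Fin 3, v c * (log (sin (faceCoord a c.1 none) * sin (faceCoord a c.1 (some c.2)) /
        (sin (faceCoord a c.1 (some (c.2 + 1))) * sin (faceCoord a c.1 (some (c.2 + 2))))) / 2))
      0 := by
  have hs : ∀ f m, sin (faceCoord a f m) ≠ 0 := fun f m =>
    (sin_pos_of_mem_Ioo (angleCoord_mem_Ioo (ha f) m)).ne'
  let b : F → Option (Fin 3) → ℝ := fun f m => faceCoord (a + v) f m - faceCoord a f m
  have h : HasDerivAt (fun t : ℝ => angleEnergy (a + t • v))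
      (∑ f, ∑ m, log (sin (faceCoord a f m)) * b f m) 0 := by
    unfold angleEnergy
    refine HasDerivAt.fun_sum fun f _ => HasDerivAt.fun_sum fun m _ => ?_
    have hseg : ∀ t : ℝ, faceCoord (a + t • v) f m = faceCoord a f m + t * b f m := fun t => by
      rw [← faceCoord_segment, add_sub_cancel_left]
    simp only [hseg]
    have hlin : HasDerivAt (fun t : ℝ => faceCoord a f m + t * b f m) (b f m) 0 := by
      simpa using ((hasDerivAt_id (0 : ℝ)).mul_const (b f m)).const_add (faceCoord a f m)
    have hout : HasDerivAt logSinPrimitive (log (sin (faceCoord a f m)))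
        (faceCoord a f m + 0 * b f m) := by
      rw [zero_mul, add_zero]
      exact hasDerivAt_logSinPrimitive (angleCoord_mem_Ioo (ha f) m)
    exact hout.comp (0 : ℝ) hlin
  -- The angle at corner `i` enters the coordinates `none` and `some i` with factor 1/2 and the
  -- other two with factor -1/2.
  convert h using 1
  rw [Fintype.sum_prod_type]
  refine Finset.sum_congr rfl fun f _ => ?_
  simp only [log_div (mul_ne_zero (hs _ _) (hs _ _)) (mul_ne_zero (hs _ _) (hs _ _)),
    log_mul (hs _ _) (hs _ _)]
  rw [Fintype.sum_option, Fin.sum_univ_three, Fin.sum_univ_three]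
  simp only [b, faceCoord, angleCoord, Pi.add_apply, Fin.isValue,
    show (0 : Fin 3) + 1 = 1 from rfl, show (0 : Fin 3) + 2 = 2 from rfl,
    show (1 : Fin 3) + 1 = 2 from rfl, show (1 : Fin 3) + 2 = 0 from rfl,
    show (2 : Fin 3) + 1 = 0 from rfl, show (2 : Fin 3) + 2 = 1 from rfl]
  ring_nf

end Energy

open SphericalTriangle

theorem apply_iterate_add_eq {α : Type*} {g : α → α} {s : α} {n : ℕ} (hs : g^[n + 1] s = s)
    (k : ℕ) : g (g^[k + n] s) = g^[k] s := by
  rw [← Function.iterate_succ_apply' g, Nat.succ_eq_add_one, add_assoc,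
    Function.iterate_add_apply, hs]

/-! ### Boundary points, cycles and minimum points on the surface. -/

namespace TriangulatedSurface

variable {F : Type*} (T : TriangulatedSurface F)

theorem edge_glue (s : F × Fin 3) : T.edge (T.glue s) = T.edge s :=
  (Quotient.sound (s := T.sideSetoid) (Or.inr rfl)).symm

theorem edgeInvariant_edge (x : F × Fin 3 → ℝ) (s : F × Fin 3) :
    T.edgeInvariant x (T.edge s) = x s + x (T.glue s) := rfl

theorem edgeInvariant_eq_iff {x : F × Fin 3 → ℝ} {D : T.Edge → ℝ} :
    T.edgeInvariant x = D ↔ ∀ s, x s + x (T.glue s) = D (T.edge s) := by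
  constructor
  · rintro rfl s
    rfl
  · intro h
    funext e
    induction e using Quotient.ind with
    | _ s => exact h s

theorem closure_angleStructures_subset (D : T.Edge → ℝ) :
    closure (T.angleStructures D) ⊆
      {x | (∀ f m, 0 ≤ faceCoord x f m) ∧ T.edgeInvariant x = D} := by
  refine closure_minimal ?_ ?_
  · rintro x ⟨hx, hxD⟩
    exact ⟨fun f m => (isSphericalAngleStructure_iff.1 hx f m).le, hxD⟩
  · simp only [edgeInvariant_eq_iff, Set.ofPred_and, Set.ofPred_forall]
    refine IsClosed.inter ?_ ?_
    · exact isClosed_iInter fun f => isClosed_iInter fun m =>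
        isClosed_le continuous_const (continuous_faceCoord f m)
    · exact isClosed_iInter fun s => isClosed_eq (by fun_prop) continuous_const

theorem isCompact_closure_angleStructures (D : T.Edge → ℝ) :
    IsCompact (closure (T.angleStructures D)) := by
  refine (isCompact_univ_pi fun _ : F × Fin 3 => isCompact_Icc (a := 0) (b := π)).closure_of_subset
    fun x hx c _ => ?_
  exact ⟨(hx.1.1 c).1.le, (hx.1.1 c).2.le⟩

/-- The cycle obtained from a side that returns to itself when one repeatedly crosses the edge
and goes on to the side `next s` of the triangle reached. -/
def cycleOfIterate (next : F × Fin 3 → F × Fin 3) (s : F × Fin 3) (n : ℕ)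
    (hs : next^[n + 1] s = s) (h : ∀ k, (next (next^[k] s)).1 = (T.glue (next^[k] s)).1 ∧
      (next (next^[k] s)).2 ≠ (T.glue (next^[k] s)).2) : T.Cycle where
  n := n
  face k := (next^[k] s).1
  -- The exponent `k + n` stands for `k - 1`, by periodicity `n + 1`.
  entry k := (T.glue (next^[k + n] s)).2
  exit k := (next^[k] s).2
  entry_ne_exit k := by
    have := (h (k + n)).2.symm
    rwa [apply_iterate_add_eq hs] at this
  glue_exit k := by
    have hp : Function.IsPeriodicPt next (n + 1) s := hs
    have h1 : next^[((k + 1 : Fin (n + 1)) : ℕ)] s = next^[k + 1] s := by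
      rw [Fin.val_add, Fin.val_one', Nat.add_mod_mod, hp.iterate_mod_apply]
    have h2 : next^[((k + 1 : Fin (n + 1)) : ℕ) + n] s = next^[k] s := by
      rw [add_comm, Function.iterate_add_apply, h1, ← Function.iterate_add_apply,
        show n + (k + 1) = k + (n + 1) by omega, Function.iterate_add_apply, hs]
    rw [h1, h2, Function.iterate_succ_apply', (h k).1]

theorem eq_zero_of_faceCoord_eq_pi {a : F × Fin 3 → ℝ} (ha : ∀ f m, 0 ≤ faceCoord a f m)
    {f : F} {p : Option (Fin 3)} (hp : faceCoord a f p = π) {m : Option (Fin 3)} (hm : m ≠ p) :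
    faceCoord a f m = 0 := by
  refine le_antisymm ?_ (ha f m)
  have h := Finset.add_le_sum (fun m _ => ha f m) (Finset.mem_univ m) (Finset.mem_univ p) hm
  rw [sum_faceCoord, hp] at h
  linarith

theorem faceCoord_none_add_some (a : F × Fin 3 → ℝ) (f : F) (i : Fin 3) :
    faceCoord a f none + faceCoord a f (some i) = a (f, i) :=
  angleCoord_none_add_some _ i

/-- If all degenerate triangles of a boundary point are vertices of the tetrahedron of all triples
of angles, then there is a `{0, 0, π}`-cycle. -/
theorem containsZeroZeroPiCycle_of_mem [Finite F] {D : T.Edge → ℝ} (hD : ∀ e, D e ≤ π)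
    {a : F × Fin 3 → ℝ} (ha : a ∈ closure (T.angleStructures D) \ T.angleStructures D)
    (hvert : ∀ f q, faceCoord a f q = 0 → ∃ p, faceCoord a f p = π) :
    T.ContainsZeroZeroPiCycle D := by
  obtain ⟨ha0, haD⟩ := T.closure_angleStructures_subset D ha.1
  have hadd := faceCoord_none_add_some a
  have hnonneg : ∀ s, 0 ≤ a s := fun s => by
    rw [← Prod.mk.eta (p := s), ← hadd]
    exact add_nonneg (ha0 _ _) (ha0 _ _)
  have hglue : ∀ s, a s = π → a (T.glue s) = 0 ∧ T.edgeInvariant a (T.edge s) = π := fun s hs => by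
    have h1 := hD (T.edge s)
    rw [← haD, edgeInvariant_edge, hs] at h1
    have h2 : a (T.glue s) = 0 := le_antisymm (by linarith) (hnonneg _)
    rw [edgeInvariant_edge, hs, h2, add_zero]
    exact ⟨rfl, rfl⟩
  have hstep : ∀ f j, a (f, j) = 0 → ∃ k, k ≠ j ∧ a (f, k) = π ∧ ∀ i, i ≠ k → a (f, i) = 0 := by
    intro f j h0
    have hj := hadd f j
    -- A zero angle is a sum of two nonnegative coordinates, so both vanish. This leaves as vertex
    -- only one whose angle π is at another corner.
    have hn : faceCoord a f none = 0 := le_antisymm (by linarith [ha0 f (some j)]) (ha0 _ _)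
    have hj' : faceCoord a f (some j) = 0 := by linarith
    obtain ⟨p, hp⟩ := hvert f _ hn
    rcases p with _ | k
    · exact absurd (hn.symm.trans hp) pi_pos.ne
    · refine ⟨k, ?_, ?_, fun i hi => ?_⟩
      · rintro rfl
        exact pi_pos.ne (hj'.symm.trans hp)
      · rw [← hadd, hn, hp, zero_add]
      · rw [← hadd, hn, eq_zero_of_faceCoord_eq_pi ha0 hp (by simpa using hi), zero_add]
  obtain ⟨s₀, hs₀⟩ : ∃ s, a s = π := by
    have : ∃ f q, faceCoord a f q = 0 := by
      by_contra! h
      exact ha.2 ⟨isSphericalAngleStructure_iff.2 fun f m => (ha0 f m).lt_of_ne' (h f m), haD⟩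
    obtain ⟨f, q, hq⟩ := this
    obtain ⟨p, hp⟩ := hvert f q hq
    -- A triangle with angles π, π, π can only serve as a starting point; the triangles reached from
    -- it have angles 0, 0, π.
    rcases p with _ | k
    · exact ⟨(f, 0), by rw [← hadd, hp, eq_zero_of_faceCoord_eq_pi ha0 hp (by simp), add_zero]⟩
    · exact ⟨(f, k), by rw [← hadd, hp, eq_zero_of_faceCoord_eq_pi ha0 hp (by simp), zero_add]⟩
  -- At sides with value other than π the successor is arbitrary; the orbit of `s₀` never meets
  -- them.
  have hnext : ∀ s, ∃ u : F × Fin 3, a s = π → u.1 = (T.glue s).1 ∧ u.2 ≠ (T.glue s).2 ∧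
      a u = π ∧ ∀ i, i ≠ u.2 → a (u.1, i) = 0 := fun s => by
    by_cases hs : a s = π
    · obtain ⟨k, hk⟩ := hstep (T.glue s).1 (T.glue s).2 (hglue s hs).1
      exact ⟨((T.glue s).1, k), fun _ => ⟨rfl, hk⟩⟩
    · exact ⟨s, fun h => absurd h hs⟩
  choose next hnext using hnext
  have hiter : ∀ k, a (next^[k] s₀) = π := fun k => by
    induction k with
    | zero => exact hs₀
    | succ k ih =>
      rw [Function.iterate_succ_apply']
      exact (hnext _ ih).2.2.1
  -- By finiteness the orbit is eventually periodic; the cycle starts where it first enters a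
  -- repetition, not necessarily at `s₀`.
  obtain ⟨i, j, hij, heq⟩ : ∃ i j, i < j ∧ next^[i] s₀ = next^[j] s₀ := by
    obtain ⟨i, j, hij, heq⟩ := Finite.exists_ne_map_eq_of_infinite fun k => next^[k] s₀
    rcases hij.lt_or_gt with h | h
    · exact ⟨i, j, h, heq⟩
    · exact ⟨j, i, h, heq.symm⟩
  set s := next^[i] s₀ with hs
  have hsk : ∀ k, a (next^[k] s) = π := fun k => by
    rw [hs, ← Function.iterate_add_apply]
    exact hiter _
  obtain ⟨n, rfl⟩ : ∃ n, j = n + 1 + i := ⟨j - i - 1, by omega⟩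
  have hper : next^[n + 1] s = s := by
    rw [hs, ← Function.iterate_add_apply, ← heq]
  refine ⟨a, ha, T.cycleOfIterate next s n hper
    fun k => ⟨(hnext _ (hsk k)).1, (hnext _ (hsk k)).2.1⟩, fun (k : Fin (n + 1)) => ?_⟩
  have hprev := hnext _ (hsk (k + n))
  rw [apply_iterate_add_eq hper] at hprev
  refine ⟨?_, (next^[k] s).2, hsk k, hprev.2.2.2⟩
  change T.edgeInvariant a (T.edge ((next^[k] s).1, (T.glue (next^[k + n] s)).2)) = π
  rw [hprev.1, edge_glue]
  exact (hglue _ (hsk _)).2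

/-- The positivity conditions and the edge equations are affine, so a half-open segment from a point
of the closed polytope to an interior point stays in the interior. -/
theorem segment_mem_angleStructures {D : T.Edge → ℝ} {a x : F × Fin 3 → ℝ}
    (ha : ∀ f m, 0 ≤ faceCoord a f m) (haD : T.edgeInvariant a = D)
    (hx : x ∈ T.angleStructures D) {t : ℝ} (ht : t ∈ Set.Ioc (0 : ℝ) 1) :
    a + t • (x - a) ∈ T.angleStructures D := by
  have hx0 := isSphericalAngleStructure_iff.1 hx.1
  refine ⟨isSphericalAngleStructure_iff.2 fun f m => ?_, T.edgeInvariant_eq_iff.2 fun s => ?_⟩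
  · rw [faceCoord_segment]
    nlinarith [mul_nonneg (sub_nonneg.2 ht.2) (ha f m), mul_pos ht.1 (hx0 f m)]
  · have h1 := T.edgeInvariant_eq_iff.1 haD s
    have h2 := T.edgeInvariant_eq_iff.1 hx.2 s
    simp only [Pi.add_apply, Pi.smul_apply, Pi.sub_apply, smul_eq_mul]
    linear_combination (1 - t) * h1 + t * h2

/-- The energy has a minimum point among the spherical angle structures. -/
theorem exists_isMinOn_angleEnergy [Fintype F] {D : T.Edge → ℝ} (hD : ∀ e, D e ≤ π)
    (hcycle : ¬ T.ContainsZeroZeroPiCycle D) (hne : (T.angleStructures D).Nonempty) :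
    ∃ a ∈ T.angleStructures D, IsMinOn angleEnergy (T.angleStructures D) a := by
  obtain ⟨a, ha, hmin⟩ := (T.isCompact_closure_angleStructures D).exists_isMinOn hne.closure
    continuous_angleEnergy.continuousOn
  refine ⟨a, ?_, hmin.on_subset subset_closure⟩
  by_contra hna
  obtain ⟨ha0, haD⟩ := T.closure_angleStructures_subset D ha
  obtain ⟨f, q, hq, hp⟩ : ∃ f q, faceCoord a f q = 0 ∧ ∀ p, faceCoord a f p ≠ π := by
    by_contra! h
    exact hcycle (T.containsZeroZeroPiCycle_of_mem hD ⟨ha, hna⟩ h)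
  obtain ⟨x, hx⟩ := hne
  obtain ⟨t, ht, hlt⟩ :=
    exists_angleEnergy_segment_lt ha0 (isSphericalAngleStructure_iff.1 hx.1) hq hp
  exact hlt.not_ge (hmin (subset_closure (T.segment_mem_angleStructures ha0 haD hx ht)))

open Filter Topology in
/-- At a minimum point of the energy, the two lengths of each edge agree. -/
theorem sin_mul_sin_div_eq_of_isMinOn [Fintype F] {D : T.Edge → ℝ} {a : F × Fin 3 → ℝ}
    (ha : a ∈ T.angleStructures D) (hmin : IsMinOn angleEnergy (T.angleStructures D) a)
    {R : F × Fin 3 → ℝ} (hR : ∀ c, R c = sin (faceCoord a c.1 none) *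
      sin (faceCoord a c.1 (some c.2)) / (sin (faceCoord a c.1 (some (c.2 + 1))) *
        sin (faceCoord a c.1 (some (c.2 + 2))))) (s : F × Fin 3) :
    R (T.glue s) = R s := by
  classical
  have ha0 := isSphericalAngleStructure_iff.1 ha.1
  have hsin : ∀ f m, 0 < sin (faceCoord a f m) := fun f m =>
    sin_pos_of_mem_Ioo (angleCoord_mem_Ioo (ha0 f) m)
  have hRpos : ∀ c, 0 < R c := fun c => by
    rw [hR]
    exact div_pos (mul_pos (hsin _ _) (hsin _ _)) (mul_pos (hsin _ _) (hsin _ _))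
  -- This direction transfers angle between the two corners facing one edge and so keeps the edge
  -- invariant.
  set v : F × Fin 3 → ℝ := Pi.single s 1 - Pi.single (T.glue s) 1 with hv
  have hvg : ∀ u, v u + v (T.glue u) = 0 := fun u => by
    have h1 : T.glue u = s ↔ u = T.glue s :=
      ⟨fun h => by rw [← h, T.glue_glue], fun h => by rw [h, T.glue_glue]⟩
    have h2 : T.glue u = T.glue s ↔ u = s :=
      ⟨fun h => by rw [← T.glue_glue u, h, T.glue_glue], fun h => by rw [h]⟩
    simp only [hv, Pi.sub_apply, Pi.single_apply, h1, h2]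
    ring
  have hder := hasDerivAt_angleEnergy (v := v) ha0
  simp only [← hR] at hder
  -- Being an angle structure is an open condition, so small variations in both directions are
  -- admissible.
  have hloc : IsLocalMin (fun t : ℝ => angleEnergy (a + t • v)) 0 := by
    have hpos : ∀ᶠ t in 𝓝 (0 : ℝ), ∀ f m, 0 < faceCoord (a + t • v) f m := by
      refine eventually_all.2 fun f => eventually_all.2 fun m => ?_
      have hc : Continuous fun t : ℝ => faceCoord (a + t • v) f m :=
        (continuous_faceCoord f m).comp (by fun_prop)
      refine (hc.tendsto 0).eventually_const_lt ?_
      rw [zero_smul, add_zero]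
      exact ha0 f m
    filter_upwards [hpos] with t ht
    rw [zero_smul, add_zero]
    refine hmin ⟨isSphericalAngleStructure_iff.2 ht, T.edgeInvariant_eq_iff.2 fun u => ?_⟩
    have h1 := T.edgeInvariant_eq_iff.1 ha.2 u
    simp only [Pi.add_apply, Pi.smul_apply, smul_eq_mul]
    linear_combination h1 + t * hvg u
  have h0 := hloc.hasDerivAt_eq_zero hder
  simp only [hv, Pi.sub_apply, sub_mul, Finset.sum_sub_distrib, Pi.single_apply, ite_mul, one_mul,
    zero_mul, Finset.sum_ite_eq', Finset.mem_univ, if_true] at h0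
  exact log_injOn_pos (hRpos _) (hRpos _) (by linarith)

end TriangulatedSurface

/-! ### Gluing the triangles of a minimum point. -/

open SphericalTriangle in
theorem theorem2p1 {F : Type*} [Finite F] (T : TriangulatedSurface F) (D : T.Edge → ℝ)
    (hD : ∀ e, D e ∈ Set.Ioc 0 Real.pi)
    (hcycle : ¬ T.ContainsZeroZeroPiCycle D)
    (hangle : ∃ x : F × Fin 3 → ℝ,
      TriangulatedSurface.IsSphericalAngleStructure x ∧ T.edgeInvariant x = D) :
    ∃ l : T.SphericalPolyhedronMetric, l.edgeInvariant = D := by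
  cases nonempty_fintype F
  obtain ⟨a, ha, hmin⟩ := T.exists_isMinOn_angleEnergy (fun e => (hD e).2) hcycle hangle
  have hIoo := ha.1.1
  choose t ht using ha.1.2
  have htx : ∀ f, (t f).innerAngle = fun i => a (f, i) := fun f => funext (ht f)
  -- The quotient is tan² of half the side, which determines a side in (0, π).
  have hR := T.sin_mul_sin_div_eq_of_isMinOn ha hmin
    (R := fun s => (1 - Real.cos ((t s.1).sideLength s.2)) / (1 + Real.cos ((t s.1).sideLength s.2)))
    (fun s => by
      have h := (t s.1).cos_sideLength_eq (fun i => by rw [ht]; exact hIoo _) s.2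
      rwa [htx] at h)
  have hlen : ∀ s : F × Fin 3, (t (T.glue s).1).sideLength (T.glue s).2 =
      (t s.1).sideLength s.2 := fun s => by
    refine Real.injOn_cos (sideLength_mem _ _) (sideLength_mem _ _) ?_
    have h := hR s
    have h1 := abs_cos_lt_one ((t (T.glue s).1).sin_sideLength_pos (T.glue s).2)
    have h2 := abs_cos_lt_one ((t s.1).sin_sideLength_pos s.2)
    rw [div_eq_div_iff (by linarith) (by linarith)] at h
    linarith
  let l : T.SphericalPolyhedronMetric :=
    { length := Quotient.lift (fun s => (t s.1).sideLength s.2) (by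
        rintro s u (rfl | rfl)
        · rfl
        · exact (hlen s).symm)
      length_mem := fun e => by
        induction e using Quotient.ind with
        | _ s => exact (t s.1).sideLength_mem_Ioo s.2
      exists_triangle := fun f => ⟨t f, fun i => rfl⟩ }
  refine ⟨l, ?_⟩
  have hl : l.innerAngle = a := funext fun c =>
    (l.innerAngle_eq c.1 (t c.1) (fun _ => rfl) c.2).trans (ht c.1 c.2)
  rw [TriangulatedSurface.SphericalPolyhedronMetric.edgeInvariant, hl]
  exact ha.2
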